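/- Let $p$ be a prime. For a group $H$ and $n\ge 1$ let $H^n$ denote the subgroup generated by the $n$-th powers of elements of $H$. A pro-$p$ group $H$ is called uniform if it is (topologically) finitely generated, $H/H^p$ is abelian (for $p=2$: $H/H^4$ is abelian), and for every $i\ge 0$ the $p$-th power map induces a group isomorphism $H^{p^i}/H^{p^{i+1}}\to H^{p^{i+1}}/H^{p^{i+2}}$. A topological group is called a $p$-adic Lie group if it has an open uniform subgroup. A Lie filtration of a $p$-adic Lie group $G$ is a descending sequence of open subgroups $G(0)\ge G(1)\ge\cdots$ of $G$ with $G(0)$ uniform and $G(i)=G(0)^{p^i}$ for all $i\ge 0$. Theorem. Let $G$ be a $p$-adic Lie group and $\Gamma$ a closed subgroup of $G$. Then $\Gamma$, with the subspace topology, is a $p$-adic Lie group. Moreover, if $H$ is any open uniform subgroup of $G$, then there is $k_0$ such that for all $k\ge k_0$ the group $H^{p^k}\cap\Gamma$ is open in $\Gamma$ and uniform, and the groups $H^{p^{k+i}}\cap\Gamma$ ($i\ge 0$) form a Lie filtration $$\Gamma\ \ge\ H^{p^k}\cap\Gamma\ \ge\ H^{p^{k+1}}\cap\Gamma\ \ge\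 \cdots$$ of $\Gamma$; in particular $(H^{p^k}\cap\Gamma)^{p^i}=H^{p^{k+i}}\cap\Gamma$ for all $i\ge 0$. If $H$ is normal in $G$, then all the groups $H^{p^{k+i}}\cap\Gamma$ are normal in $\Gamma$. -/

import Mathlib

namespace PAdicLie

/-- For a subgroup `H` of `G`, the subgroup `H ^ n`, generated by the `n`-th powers of the
elements of `H`. For a group `H` by itself, `H ^ n` is `powSubgroup (⊤ : Subgroup H) n`. -/
def powSubgroup {G : Type*} [Group G] (H : Subgroup G) (n : ℕ) : Subgroup G :=
  Subgroup.closure ((fun x : G => x ^ n) '' (H : Set G))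

/-- `H ^ n` is normal as soon as `H` is; in particular `H ^ n` is always normal in `H`. -/
instance powSubgroup_normal {G : Type*} [Group G] (H : Subgroup G) [hH : H.Normal] (n : ℕ) :
    (powSubgroup H n).Normal := by
  refine ⟨fun x hx g => ?_⟩
  have hle : powSubgroup H n ≤ (powSubgroup H n).comap (MulAut.conj g).toMonoidHom := by
    unfold powSubgroup
    rw [Subgroup.closure_le]
    rintro _ ⟨y, hy, rfl⟩
    refine Subgroup.subset_closure ⟨g * y * g⁻¹, hH.conj_mem y hy g, ?_⟩
    simp [conj_pow]
  simpa using hle hx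

/-- A pro-`p` group: a profinite (compact, Hausdorff, totally disconnected) topological group in
which every open normal subgroup has index a power of `p`. -/
structure IsProP (p : ℕ) (H : Type*) [Group H] [TopologicalSpace H] : Prop where
  isTopologicalGroup : IsTopologicalGroup H
  compactSpace : CompactSpace H
  t2Space : T2Space H
  totallyDisconnectedSpace : TotallyDisconnectedSpace H
  index_eq : ∀ N : Subgroup H, N.Normal → IsOpen (N : Set H) → ∃ m : ℕ, N.index = p ^ m

/-- A topological group is (topologically) finitely generated if some finite subset generates
a dense subgroup. -/
def IsTopologicallyFG (H : Type*) [Group H] [TopologicalSpace H] : Prop :=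
  ∃ s : Set H, s.Finite ∧ Dense (Subgroup.closure s : Set H)

/-- The `p`-th power map induces a group isomorphism
`H ^ (p ^ i) / H ^ (p ^ (i + 1)) → H ^ (p ^ (i + 1)) / H ^ (p ^ (i + 2))`. -/
def IsShiftIso (p : ℕ) (H : Type*) [Group H] (i : ℕ) : Prop :=
  ∃ (h : ∀ x ∈ powSubgroup (⊤ : Subgroup H) (p ^ i),
      x ^ p ∈ powSubgroup (⊤ : Subgroup H) (p ^ (i + 1)))
    (φ : (powSubgroup (⊤ : Subgroup H) (p ^ i) ⧸
            (powSubgroup (⊤ : Subgroup H) (p ^ (i + 1))).subgroupOf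
              (powSubgroup (⊤ : Subgroup H) (p ^ i))) ≃*
          (powSubgroup (⊤ : Subgroup H) (p ^ (i + 1)) ⧸
            (powSubgroup (⊤ : Subgroup H) (p ^ (i + 2))).subgroupOf
              (powSubgroup (⊤ : Subgroup H) (p ^ (i + 1))))),
    ∀ x : powSubgroup (⊤ : Subgroup H) (p ^ i),
      φ (QuotientGroup.mk x) = QuotientGroup.mk ⟨(x : H) ^ p, h x x.2⟩

/-- A uniform pro-`p` group: a finitely generated pro-`p` group `H` such that `H / H ^ p`
(`H / H ^ 4` if `p = 2`) is abelian and the `p`-th power map induces shift isomorphisms. -/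
structure IsUniform (p : ℕ) (H : Type*) [Group H] [TopologicalSpace H] : Prop where
  isProP : IsProP p H
  finitelyGenerated : IsTopologicallyFG H
  abelian : ∀ a b : H ⧸ powSubgroup (⊤ : Subgroup H) (if p = 2 then 4 else p), a * b = b * a
  shift : ∀ i : ℕ, IsShiftIso p H i

/-- A `p`-adic Lie group: a topological group with an open uniform subgroup. -/
def IsPAdicLieGroup (p : ℕ) (G : Type*) [Group G] [TopologicalSpace G] : Prop :=
  IsTopologicalGroup G ∧ ∃ H : Subgroup G, IsOpen (H : Set G) ∧ IsUniform p H

/-- A Lie filtration of `G`: the descending sequence of open subgroups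
`G(i) = U ^ (p ^ i)` attached to an open uniform subgroup `U = G(0)` of `G`. -/
structure IsLieFiltration (p : ℕ) {G : Type*} [Group G] [TopologicalSpace G]
    (F : ℕ → Subgroup G) : Prop where
  uniform_zero : IsUniform p (F 0)
  isOpen : ∀ i : ℕ, IsOpen (F i : Set G)
  antitone : Antitone F
  eq_pow : ∀ i : ℕ, F i = powSubgroup (F 0) (p ^ i)

end PAdicLie

/-!
Let `U i = H ^ (p ^ i)` and `Γ i = U i ⊓ Γ`. The `p`-th power map induces an injective homomorphism
`Γ i / Γ (i + 1) → Γ (i + 1) / Γ (i + 2)`, the restriction of the shift isomorphism of `H`. So the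
indices of consecutive `Γ i` do not decrease, and they are bounded by `|H / H ^ p|`. They are
eventually constant, say from `k₀` on, and from there the graded power maps of `Γ` are bijective
(`IsOpenPowerFiltration.exists_isPowSurjective_shift`).

To return from the graded pieces to the groups, use the congruence
`(a * b) ^ p ≡ a ^ p * b ^ p` modulo `U (i + 2)` for `b ∈ U i` and any `a ∈ H`
(`IsPowerFiltration.mul_pow_congr`), which follows from `⁅U i, H⁆ ≤ U (i + 1)`
(`⁅U i, H⁆ ≤ U (i + 2)` for `p = 2`). It allows `p`-th roots to be improved step by step, and
compactness gives exact ones (`IsPowerFiltration.exists_pow_eq`): each element of `Γ (k + i)` with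
`k ≥ k₀` is a `p ^ i`-th power of an element of `Γ k`. This yields `(Γ k) ^ (p ^ i) = Γ (k + i)`, and
then all the conditions for `Γ k` to be uniform can be read off from the filtration.

The facts about `U i` come from the definition of uniformity. The commutator estimates are proved by
induction: the shift map `x ↦ x ^ p` is multiplicative modulo `U (i + 2)` on `U i` and kills
`U (i + 1)`, so that it takes conjugate elements to the same class. The `U i` are closed, being the
sets of `p ^ i`-th powers of a compact group by the root argument above applied to `H` itself, and of
finite index, because a topologically finitely generated abelian group of exponent `p` is finite.

Everything is organized around `IsOpenPowerFiltration`, a weakening of the properties of `U i` that is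
inherited by closed subgroups.
-/

namespace PAdicLie

open scoped Topology commutatorElement

/-! ### Power filtrations -/

/-- The number of steps that commutators descend in a uniform pro-`p` group: two if `p = 2`, one
otherwise. -/
def commDepth (p : ℕ) : ℕ := if p = 2 then 2 else 1

theorem one_le_commDepth (p : ℕ) : 1 ≤ commDepth p := by
  unfold commDepth; split <;> simp

theorem ite_eq_pow_commDepth (p : ℕ) : (if p = 2 then 4 else p) = p ^ commDepth p := by
  unfold commDepth
  split_ifs with h2
  · rw [h2]
    rfl
  · exact (pow_one p).symm

/-- The collection formula for two elements with central commutator. -/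
theorem mul_pow_of_central_commutator {Q : Type*} [Group Q] {a b c : Q} (h : b * a = a * b * c)
    (ca : Commute c a) (cb : Commute c b) (n : ℕ) :
    (a * b) ^ n = a ^ n * b ^ n * c ^ (n.choose 2) := by
  have hb : ∀ n : ℕ, b ^ n * a = a * b ^ n * c ^ n := by
    intro n
    induction n with
    | zero => simp
    | succ n ih =>
      rw [pow_succ' b, mul_assoc, ih, ← mul_assoc, ← mul_assoc, h, mul_assoc (a * b),
        (cb.pow_right n).eq, pow_succ' c]
      simp only [mul_assoc]
  induction n with
  | zero => simp
  | succ n ih =>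
    have hc : n.succ.choose 2 = n + n.choose 2 := by
      rw [Nat.choose_succ_succ' n 1, Nat.choose_one_right]
    rw [pow_succ (a * b), ih, hc, mul_assoc (a ^ n * b ^ n),
      ((ca.mul_right cb).pow_left _).eq, mul_assoc (a ^ n), ← mul_assoc (b ^ n),
      ← mul_assoc (b ^ n), hb, mul_assoc (a * b ^ n), (cb.pow_left n).eq, pow_succ a, pow_succ b,
      pow_add]
    simp only [mul_assoc]

/-- A descending chain of subgroups which behaves like the chain `H ^ (p ^ i)` of a uniform group
`H = K 0`, except that the `p`-th power maps `K i / K (i + 1) → K (i + 1) / K (i + 2)` are only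
required to be well defined and injective. Unlike surjectivity, these conditions pass to the
intersections with a subgroup. -/
structure IsPowerFiltration (p : ℕ) {L : Type*} [Group L] (K : ℕ → Subgroup L) : Prop where
  antitone : Antitone K
  commutator_mem : ∀ i, ∀ x ∈ K i, ∀ y ∈ K 0, ⁅x, y⁆ ∈ K (i + commDepth p)
  pow_mem : ∀ i, ∀ x ∈ K i, x ^ p ∈ K (i + 1)
  mem_of_pow_mem : ∀ i, ∀ x ∈ K i, x ^ p ∈ K (i + 2) → x ∈ K (i + 1)

/-- The `p`-th power maps `K i / K (i + 1) → K (i + 1) / K (i + 2)` are all surjective, phrased with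
representatives. -/
def IsPowSurjective (p : ℕ) {L : Type*} [Group L] (K : ℕ → Subgroup L) : Prop :=
  ∀ i, ∀ x ∈ K (i + 1), ∃ y ∈ K i, (y ^ p)⁻¹ * x ∈ K (i + 2)

namespace IsPowerFiltration

variable {p : ℕ} {L : Type*} [Group L] {K : ℕ → Subgroup L}

theorem le_zero (h : IsPowerFiltration p K) (i : ℕ) : K i ≤ K 0 := h.antitone (Nat.zero_le i)

theorem normal_subgroupOf (h : IsPowerFiltration p K) (i : ℕ) :
    ((K i).subgroupOf (K 0)).Normal := by
  refine ⟨fun x hx y => ?_⟩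
  rw [Subgroup.mem_subgroupOf] at hx ⊢
  have h1 := h.antitone (Nat.le_add_right i _) (h.commutator_mem i _ hx _ y.2)
  have h2 := mul_mem (inv_mem h1) hx
  simpa [commutatorElement_def, mul_assoc] using h2

/-- The `p`-th power map is multiplicative modulo `K (i + 2)` as soon as one factor lies in `K i`:
modulo `K (i + 2)` the commutator `c` of the two factors is central, and `c ^ (p.choose 2)` is
trivial because `p ∣ p.choose 2` for odd `p`, and because `c` itself is trivial for `p = 2`. -/
theorem mul_pow_congr (h : IsPowerFiltration p K) (hp : p.Prime) {i : ℕ} {a b : L} (ha : a ∈ K 0)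
    (hb : b ∈ K i) : (a ^ p * b ^ p)⁻¹ * (a * b) ^ p ∈ K (i + 2) := by
  have := h.normal_subgroupOf (i + 2)
  have he := one_le_commDepth p
  have hb0 := h.le_zero _ hb
  have hc : ⁅b⁻¹, a⁻¹⁆ ∈ K (i + commDepth p) :=
    h.commutator_mem i _ (inv_mem hb) _ (inv_mem ha)
  have hc0 := h.le_zero _ hc
  have hcentral : ∀ y (hy : y ∈ K 0), Commute
      (QuotientGroup.mk' ((K (i + 2)).subgroupOf (K 0)) ⟨_, hc0⟩)
      (QuotientGroup.mk' ((K (i + 2)).subgroupOf (K 0)) ⟨y, hy⟩) := by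
    intro y hy
    rw [← commutatorElement_eq_one_iff_commute, ← map_commutatorElement,
      QuotientGroup.mk'_apply, QuotientGroup.eq_one_iff, Subgroup.mem_subgroupOf]
    exact h.antitone (by omega) (h.commutator_mem _ _ hc _ hy)
  have hpow : (QuotientGroup.mk' ((K (i + 2)).subgroupOf (K 0)) ⟨_, hc0⟩) ^ (p.choose 2) = 1 := by
    rw [← map_pow, QuotientGroup.mk'_apply, QuotientGroup.eq_one_iff, Subgroup.mem_subgroupOf]
    by_cases h2 : p = 2
    · rw [commDepth, if_pos h2] at hc
      exact Subgroup.pow_mem _ hc _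
    · obtain ⟨k, hk⟩ := hp.dvd_choose_self two_ne_zero (hp.two_le.lt_of_ne' h2)
      rw [hk, pow_mul]
      exact Subgroup.pow_mem _
        (h.pow_mem (i + 1) _ (h.antitone (Nat.add_le_add_left he i) hc)) _
  have key := mul_pow_of_central_commutator
    (a := QuotientGroup.mk' ((K (i + 2)).subgroupOf (K 0)) ⟨a, ha⟩)
    (b := QuotientGroup.mk' ((K (i + 2)).subgroupOf (K 0)) ⟨b, hb0⟩)
    (by
      rw [← map_mul, ← map_mul, ← map_mul]
      congr 1
      ext
      simp [commutatorElement_def, mul_assoc]) (hcentral a ha) (hcentral b hb0) p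
  rw [hpow, mul_one, ← map_mul, ← map_pow, ← map_pow, ← map_pow, ← map_mul, eq_comm,
    QuotientGroup.mk'_apply, QuotientGroup.mk'_apply, QuotientGroup.eq,
    Subgroup.mem_subgroupOf] at key
  exact key

theorem shift (h : IsPowerFiltration p K) (k : ℕ) : IsPowerFiltration p (fun i => K (k + i)) where
  antitone _ _ hij := h.antitone (Nat.add_le_add_left hij k)
  commutator_mem i x hx y hy := by
    simpa only [add_assoc] using h.commutator_mem (k + i) x hx y (h.le_zero _ hy)
  pow_mem i := h.pow_mem (k + i)
  mem_of_pow_mem i := h.mem_of_pow_mem (k + i)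

theorem subgroupOf (h : IsPowerFiltration p K) (Γ : Subgroup L) :
    IsPowerFiltration p (fun i => (K i).subgroupOf Γ) where
  antitone _ _ hij := Subgroup.comap_mono (h.antitone hij)
  commutator_mem i x hx y hy := h.commutator_mem i x hx y hy
  pow_mem i x := h.pow_mem i x
  mem_of_pow_mem i x := h.mem_of_pow_mem i x

theorem pow_pow_mem (h : IsPowerFiltration p K) {i : ℕ} {x : L} (hx : x ∈ K i) (n : ℕ) :
    x ^ p ^ n ∈ K (i + n) := by
  induction n with
  | zero => simpa using hx
  | succ n ih =>
    rw [pow_succ, pow_mul]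
    exact h.pow_mem _ _ ih

/-- If the graded power maps are surjective, every element of `K (j + 1)` is a `p`-th power of an
element of `K j` up to an arbitrarily small error. -/
theorem exists_pow_congr (h : IsPowerFiltration p K) (hp : p.Prime) (hs : IsPowSurjective p K)
    {j : ℕ} {x : L} (hx : x ∈ K (j + 1)) (n : ℕ) : ∃ y ∈ K j, (y ^ p)⁻¹ * x ∈ K (j + n + 1) := by
  induction n with
  | zero => exact ⟨1, one_mem _, by simpa using hx⟩
  | succ n ih =>
    obtain ⟨y, hy, hyx⟩ := ih
    obtain ⟨z, hz, hzx⟩ := hs _ _ hyx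
    refine ⟨y * z, mul_mem hy (h.antitone (Nat.le_add_right j n) hz), ?_⟩
    have h1 := h.mul_pow_congr hp (h.le_zero _ hy) hz
    have h2 := mul_mem (inv_mem h1) hzx
    rw [show j + n + 2 = j + (n + 1) + 1 by omega] at h2
    simpa [mul_assoc] using h2

/-- Approximate `p`-th roots give exact ones, as the set of `p`-th powers of the elements of the
compact set `K j` is closed. No `K n` is assumed closed here: for a uniform group this lemma is what
proves that the abstract subgroups `H ^ (p ^ i)` are closed. -/
theorem exists_pow_eq [TopologicalSpace L] [IsTopologicalGroup L] [T2Space L]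
    (h : IsPowerFiltration p K) (hp : p.Prime) (hs : IsPowSurjective p K)
    (hb : ∀ W ∈ 𝓝 (1 : L), ∃ n, (K n : Set L) ⊆ W) {j : ℕ} (hc : IsCompact (K j : Set L))
    {x : L} (hx : x ∈ K (j + 1)) : ∃ y ∈ K j, y ^ p = x := by
  have hcl : IsClosed ((fun y : L => y ^ p) '' (K j : Set L)) :=
    (hc.image (continuous_pow p)).isClosed
  suffices hmem : x ∈ closure ((fun y : L => y ^ p) '' (K j : Set L)) by
    rwa [hcl.closure_eq] at hmem
  rw [mem_closure_iff_nhds]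
  intro W hW
  have hW' : (fun z : L => x * z⁻¹) ⁻¹' W ∈ 𝓝 (1 : L) :=
    (by fun_prop : Continuous fun z : L => x * z⁻¹).continuousAt.preimage_mem_nhds
      (by simpa using hW)
  obtain ⟨n, hn⟩ := hb _ hW'
  obtain ⟨y, hy, hyx⟩ := h.exists_pow_congr hp hs hx n
  refine ⟨y ^ p, ?_, y, hy, rfl⟩
  have := hn (h.antitone (by omega : n ≤ j + n + 1) hyx)
  simpa using this

theorem coe_eq_image_pow [TopologicalSpace L] [IsTopologicalGroup L] [T2Space L]
    (h : IsPowerFiltration p K) (hp : p.Prime) (hs : IsPowSurjective p K)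
    (hb : ∀ W ∈ 𝓝 (1 : L), ∃ n, (K n : Set L) ⊆ W) (hc : IsCompact (K 0 : Set L)) (j : ℕ) :
    (K j : Set L) = (fun y : L => y ^ p ^ j) '' (K 0 : Set L) := by
  induction j with
  | zero => simp
  | succ j ih =>
    have hcj : IsCompact (K j : Set L) := ih ▸ hc.image (continuous_pow _)
    ext x
    constructor
    · intro hx
      obtain ⟨y, hy, rfl⟩ := h.exists_pow_eq hp hs hb hcj hx
      obtain ⟨z, hz, rfl⟩ : y ∈ (fun y : L => y ^ p ^ j) '' (K 0 : Set L) := ih ▸ hy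
      exact ⟨z, hz, by simp only [pow_succ, pow_mul]⟩
    · rintro ⟨z, hz, rfl⟩
      have := h.pow_pow_mem hz (j + 1)
      rwa [zero_add] at this

theorem powSubgroup_eq [TopologicalSpace L] [IsTopologicalGroup L] [T2Space L]
    (h : IsPowerFiltration p K) (hp : p.Prime) (hs : IsPowSurjective p K)
    (hb : ∀ W ∈ 𝓝 (1 : L), ∃ n, (K n : Set L) ⊆ W) (hc : IsCompact (K 0 : Set L)) (j : ℕ) :
    powSubgroup (K 0) (p ^ j) = K j := by
  rw [powSubgroup, ← h.coe_eq_image_pow hp hs hb hc, Subgroup.closure_eq]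

end IsPowerFiltration

/-- A power filtration by compact open subgroups shrinking to `1`, with the indices of consecutive
members bounded. -/
structure IsOpenPowerFiltration (p : ℕ) {L : Type*} [Group L] [TopologicalSpace L]
    (K : ℕ → Subgroup L) : Prop extends IsPowerFiltration p K where
  isOpen : ∀ i, IsOpen (K i : Set L)
  isCompact : IsCompact (K 0 : Set L)
  exists_subset : ∀ W ∈ 𝓝 (1 : L), ∃ n, (K n : Set L) ⊆ W
  exists_relIndex_le : ∃ B, ∀ i, (K (i + 1)).relIndex (K i) ≤ B

/-! ### Eventual surjectivity of the power maps -/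

namespace IsPowerFiltration

variable {p : ℕ} {L : Type*} [Group L] {K : ℕ → Subgroup L}

/-- The `p`-th power of a representative embeds `K i / K (i + 1)` into `K (i + 1) / K (i + 2)`. -/
theorem exists_injective_pow (h : IsPowerFiltration p K) (hp : p.Prime) (i : ℕ) :
    ∃ f : K i ⧸ (K (i + 1)).subgroupOf (K i) → K (i + 1) ⧸ (K (i + 2)).subgroupOf (K (i + 1)),
      Function.Injective f ∧
      ∀ q, ∃ y, ∃ hy : y ∈ K i, f q = QuotientGroup.mk ⟨y ^ p, h.pow_mem i y hy⟩ := by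
  refine ⟨fun q => QuotientGroup.mk ⟨(q.out : L) ^ p, h.pow_mem i _ q.out.2⟩, fun q r hqr => ?_,
    fun q => ⟨q.out, q.out.2, rfl⟩⟩
  have h1 : ((q.out : L) ^ p)⁻¹ * (r.out : L) ^ p ∈ K (i + 2) := by
    simpa [QuotientGroup.eq, Subgroup.mem_subgroupOf] using hqr
  have hc : (q.out : L)⁻¹ * r.out ∈ K i := mul_mem (inv_mem q.out.2) r.out.2
  have h2 := h.mul_pow_congr hp (h.le_zero _ q.out.2) hc
  rw [mul_inv_cancel_left] at h2
  have h3 : ((q.out : L)⁻¹ * r.out) ^ p ∈ K (i + 2) := by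
    simpa [mul_assoc] using mul_mem h1 (inv_mem h2)
  have h4 := h.mem_of_pow_mem i _ hc h3
  rw [← QuotientGroup.out_eq' q, ← QuotientGroup.out_eq' r, QuotientGroup.eq,
    Subgroup.mem_subgroupOf]
  exact h4

theorem relIndex_le_succ (h : IsPowerFiltration p K) (hp : p.Prime) {i : ℕ}
    (hi : (K (i + 2)).relIndex (K (i + 1)) ≠ 0) :
    (K (i + 1)).relIndex (K i) ≤ (K (i + 2)).relIndex (K (i + 1)) := by
  obtain ⟨f, hf, -⟩ := h.exists_injective_pow hp i
  have : Finite (K (i + 1) ⧸ (K (i + 2)).subgroupOf (K (i + 1))) := Nat.finite_of_card_ne_zero hi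
  exact Nat.card_le_card_of_injective f hf

theorem exists_pow_congr_of_relIndex_le (h : IsPowerFiltration p K) (hp : p.Prime) {i : ℕ}
    (hi : (K (i + 2)).relIndex (K (i + 1)) ≠ 0)
    (hle : (K (i + 2)).relIndex (K (i + 1)) ≤ (K (i + 1)).relIndex (K i)) {x : L}
    (hx : x ∈ K (i + 1)) : ∃ y ∈ K i, (y ^ p)⁻¹ * x ∈ K (i + 2) := by
  obtain ⟨f, hf, hfy⟩ := h.exists_injective_pow hp i
  have : Finite (K (i + 1) ⧸ (K (i + 2)).subgroupOf (K (i + 1))) := Nat.finite_of_card_ne_zero hi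
  obtain ⟨q, hq⟩ := (hf.bijective_of_nat_card_le hle).2 (QuotientGroup.mk ⟨x, hx⟩)
  obtain ⟨y, hy, hyq⟩ := hfy q
  refine ⟨y, hy, ?_⟩
  simpa [QuotientGroup.eq, Subgroup.mem_subgroupOf] using hyq.symm.trans hq

end IsPowerFiltration

namespace IsOpenPowerFiltration

variable {p : ℕ} {L : Type*} [Group L] [TopologicalSpace L] [IsTopologicalGroup L]
  {K : ℕ → Subgroup L}

theorem isCompact_coe (h : IsOpenPowerFiltration p K) (i : ℕ) : IsCompact (K i : Set L) :=
  h.isCompact.of_isClosed_subset (Subgroup.isClosed_of_isOpen _ (h.isOpen i)) (h.le_zero i)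

theorem relIndex_ne_zero (h : IsOpenPowerFiltration p K) (i j : ℕ) :
    (K j).relIndex (K i) ≠ 0 := by
  have : CompactSpace (K i) := isCompact_iff_compactSpace.mp (h.isCompact_coe i)
  have : Finite (K i ⧸ (K j).subgroupOf (K i)) :=
    Subgroup.quotient_finite_of_isOpen _ ((h.isOpen j).preimage continuous_subtype_val)
  exact Nat.card_pos.ne'

theorem shift (h : IsOpenPowerFiltration p K) (k : ℕ) :
    IsOpenPowerFiltration p (fun i => K (k + i)) where
  toIsPowerFiltration := h.toIsPowerFiltration.shift k
  isOpen i := h.isOpen (k + i)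
  isCompact := h.isCompact_coe k
  exists_subset W hW := by
    obtain ⟨n, hn⟩ := h.exists_subset W hW
    exact ⟨n, fun x hx => hn (h.antitone (Nat.le_add_left n k) hx)⟩
  exists_relIndex_le := by
    obtain ⟨B, hB⟩ := h.exists_relIndex_le
    exact ⟨B, fun i => hB (k + i)⟩

theorem subgroupOf (h : IsOpenPowerFiltration p K) {Γ : Subgroup L}
    (hΓ : IsClosed (Γ : Set L)) : IsOpenPowerFiltration p (fun i => (K i).subgroupOf Γ) where
  toIsPowerFiltration := h.toIsPowerFiltration.subgroupOf Γ
  isOpen i := (h.isOpen i).preimage continuous_subtype_val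
  isCompact := hΓ.isClosedEmbedding_subtypeVal.isCompact_preimage h.isCompact
  exists_subset W hW := by
    obtain ⟨W', hW', hsub⟩ := mem_nhds_subtype _ _ _ |>.mp hW
    obtain ⟨n, hn⟩ := h.exists_subset W' hW'
    exact ⟨n, fun x hx => hsub (hn hx)⟩
  exists_relIndex_le := by
    obtain ⟨B, hB⟩ := h.exists_relIndex_le
    refine ⟨B, fun i => ?_⟩
    have h1 : ((K (i + 1)).subgroupOf Γ).relIndex ((K i).subgroupOf Γ) =
        (K (i + 1)).relIndex (((K i).subgroupOf Γ).map Γ.subtype) :=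
      Subgroup.relIndex_comap _ _ _
    rw [h1]
    exact (Subgroup.relIndex_le_of_le_right (Subgroup.map_comap_le _ _)
      (h.relIndex_ne_zero i (i + 1))).trans (hB i)

/-- The index of `K (i + 1)` in `K i` does not decrease with `i` and is bounded, hence eventually
constant; from then on the injective graded power maps are bijective. -/
theorem exists_isPowSurjective_shift (h : IsOpenPowerFiltration p K) (hp : p.Prime) :
    ∃ k₀, ∀ k ≥ k₀, IsPowSurjective p (fun i => K (k + i)) := by
  obtain ⟨B, hB⟩ := h.exists_relIndex_le
  have hmono : Monotone fun i => (K (i + 1)).relIndex (K i) :=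
    monotone_nat_of_le_succ fun i => h.relIndex_le_succ hp (h.relIndex_ne_zero _ _)
  have hbdd : BddAbove (Set.range fun i => (K (i + 1)).relIndex (K i)) :=
    ⟨B, by rintro _ ⟨i, rfl⟩; exact hB i⟩
  obtain ⟨k₀, hk₀⟩ := Nat.sSup_mem (Set.range_nonempty _) hbdd
  refine ⟨k₀, fun k hk i x hx => ?_⟩
  refine h.exists_pow_congr_of_relIndex_le hp (h.relIndex_ne_zero _ _) ?_ hx
  exact ((le_csSup hbdd ⟨k + i + 1, rfl⟩).trans hk₀.ge).trans
    (hmono (hk.trans (Nat.le_add_right k i)))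

end IsOpenPowerFiltration

/-! ### From power filtrations to uniform groups -/

theorem isShiftIso_of_pow {p i : ℕ} {H : Type*} [Group H]
    (hpow : ∀ x ∈ powSubgroup (⊤ : Subgroup H) (p ^ i),
      x ^ p ∈ powSubgroup (⊤ : Subgroup H) (p ^ (i + 1)))
    (hmul : ∀ x ∈ powSubgroup (⊤ : Subgroup H) (p ^ i), ∀ y ∈ powSubgroup (⊤ : Subgroup H) (p ^ i),
      (x ^ p * y ^ p)⁻¹ * (x * y) ^ p ∈ powSubgroup (⊤ : Subgroup H) (p ^ (i + 2)))
    (hker : ∀ x ∈ powSubgroup (⊤ : Subgroup H) (p ^ i),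
      x ^ p ∈ powSubgroup (⊤ : Subgroup H) (p ^ (i + 2)) ↔
      x ∈ powSubgroup (⊤ : Subgroup H) (p ^ (i + 1)))
    (hsurj : ∀ x ∈ powSubgroup (⊤ : Subgroup H) (p ^ (i + 1)),
      ∃ y ∈ powSubgroup (⊤ : Subgroup H) (p ^ i),
        (y ^ p)⁻¹ * x ∈ powSubgroup (⊤ : Subgroup H) (p ^ (i + 2))) :
    IsShiftIso p H i := by
  let N := (powSubgroup (⊤ : Subgroup H) (p ^ (i + 2))).subgroupOf
    (powSubgroup (⊤ : Subgroup H) (p ^ (i + 1)))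
  let g : powSubgroup (⊤ : Subgroup H) (p ^ i) →* powSubgroup (⊤ : Subgroup H) (p ^ (i + 1)) ⧸ N :=
    MonoidHom.mk' (fun x => QuotientGroup.mk ⟨(x : H) ^ p, hpow x x.2⟩) (fun x y => by
      rw [← QuotientGroup.mk_mul, eq_comm, QuotientGroup.eq, Subgroup.mem_subgroupOf]
      exact hmul x x.2 y y.2)
  have hg : g.ker = (powSubgroup (⊤ : Subgroup H) (p ^ (i + 1))).subgroupOf
      (powSubgroup (⊤ : Subgroup H) (p ^ i)) := by
    ext x
    rw [MonoidHom.mem_ker, Subgroup.mem_subgroupOf, ← hker x x.2]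
    exact (QuotientGroup.eq_one_iff _).trans Subgroup.mem_subgroupOf
  have hgs : Function.Surjective g := by
    intro q
    obtain ⟨x, rfl⟩ := QuotientGroup.mk_surjective q
    obtain ⟨y, hy, hyx⟩ := hsurj x x.2
    refine ⟨⟨y, hy⟩, ?_⟩
    exact QuotientGroup.eq.mpr (Subgroup.mem_subgroupOf.mpr hyx)
  exact ⟨hpow, (QuotientGroup.quotientMulEquivOfEq hg.symm).trans
    (QuotientGroup.quotientKerEquivOfSurjective g hgs), fun x => rfl⟩

/-- If the graded power maps are surjective, a subgroup that covers `K 0 / K 1` covers every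
`K n / K (n + 1)`. -/
theorem IsPowerFiltration.exists_mem_of_isPowSurjective {p : ℕ} (hp : p.Prime) {L : Type*} [Group L]
    {K : ℕ → Subgroup L} (h : IsPowerFiltration p K) (hs : IsPowSurjective p K)
    {D : Subgroup L} (hD : ∀ x ∈ K 0, ∃ d ∈ D, d⁻¹ * x ∈ K 1) (n : ℕ) {x : L} (hx : x ∈ K n) :
    ∃ d ∈ D, d⁻¹ * x ∈ K (n + 1) := by
  induction n generalizing x with
  | zero => exact hD x hx
  | succ n ih =>
    obtain ⟨y, hy, hyx⟩ := hs n x hx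
    obtain ⟨d, hd, hdy⟩ := ih hy
    refine ⟨d ^ p, D.pow_mem hd p, ?_⟩
    have hdK : d ∈ K 0 := by
      have := mul_mem (h.le_zero _ hy) (inv_mem (h.le_zero _ hdy))
      simpa using this
    have h1 := h.mul_pow_congr hp hdK (h.antitone (Nat.le_succ n) hdy)
    have h2 := h.pow_mem _ _ hdy
    rw [mul_inv_cancel_left] at h1
    have := mul_mem (mul_mem h2 h1) hyx
    simpa [mul_assoc] using this

namespace IsOpenPowerFiltration

variable {p : ℕ} {L : Type*} [Group L] [TopologicalSpace L] [IsTopologicalGroup L]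
  {K : ℕ → Subgroup L}

theorem isProP (h : IsOpenPowerFiltration p K) (hp : p.Prime) [T2Space L] (h0 : K 0 = ⊤) :
    IsProP p L := by
  have : CompactSpace L := ⟨by simpa [h0] using h.isCompact⟩
  have : Fact p.Prime := ⟨hp⟩
  have hts : TotallySeparatedSpace L := by
    rw [totallySeparatedSpace_iff_exists_isClopen]
    intro x y hxy
    have hW : ({x⁻¹ * y}ᶜ : Set L) ∈ 𝓝 1 := by
      refine isOpen_compl_singleton.mem_nhds fun h1 => hxy ?_
      rw [Set.mem_singleton_iff, eq_comm, inv_mul_eq_one] at h1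
      exact h1
    obtain ⟨n, hn⟩ := h.exists_subset _ hW
    have hcont : Continuous fun z : L => x⁻¹ * z := by fun_prop
    refine ⟨(fun z => x⁻¹ * z) ⁻¹' (K n : Set L),
      ⟨(Subgroup.isClosed_of_isOpen _ (h.isOpen n)).preimage hcont, (h.isOpen n).preimage hcont⟩,
      by simp [one_mem], fun hy => hn hy rfl⟩
  refine ⟨inferInstance, inferInstance, inferInstance, inferInstance, fun N hN hNo => ?_⟩
  -- `K n ≤ N` for some `n`, so the exponent of `L ⧸ N` divides `p ^ n`.
  obtain ⟨n, hn⟩ := h.exists_subset N (hNo.mem_nhds (one_mem N))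
  have hfin : Finite (L ⧸ N) := N.quotient_finite_of_isOpen hNo
  have hpg : IsPGroup p (L ⧸ N) := by
    intro q
    obtain ⟨x, rfl⟩ := QuotientGroup.mk_surjective q
    refine ⟨n, ?_⟩
    rw [← QuotientGroup.mk_pow, QuotientGroup.eq_one_iff]
    have hx : x ∈ K 0 := h0 ▸ Subgroup.mem_top x
    have := h.pow_pow_mem hx n
    rw [zero_add] at this
    exact hn this
  exact IsPGroup.iff_card.mp hpg

theorem isTopologicallyFG (h : IsOpenPowerFiltration p K) (hp : p.Prime) (h0 : K 0 = ⊤)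
    (hs : IsPowSurjective p K) : IsTopologicallyFG L := by
  have : CompactSpace L := ⟨by simpa [h0] using h.isCompact⟩
  have hfin : Finite (L ⧸ K 1) := (K 1).quotient_finite_of_isOpen (h.isOpen 1)
  refine ⟨Set.range (Quotient.out : L ⧸ K 1 → L), Set.finite_range _, ?_⟩
  set D := Subgroup.closure (Set.range (Quotient.out : L ⧸ K 1 → L))
  have hD : ∀ x ∈ K 0, ∃ d ∈ D, d⁻¹ * x ∈ K 1 := fun x _ =>
    ⟨(QuotientGroup.mk x : L ⧸ K 1).out, Subgroup.subset_closure ⟨_, rfl⟩,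
      QuotientGroup.eq.mp (QuotientGroup.out_eq' _)⟩
  have hDn : ∀ n x, ∃ d ∈ D, d⁻¹ * x ∈ K n := by
    intro n x
    induction n with
    | zero => exact ⟨1, one_mem _, h0 ▸ Subgroup.mem_top _⟩
    | succ n ih =>
      obtain ⟨d, hd, hdx⟩ := ih
      obtain ⟨e, he, hex⟩ := h.exists_mem_of_isPowSurjective hp hs hD n hdx
      exact ⟨d * e, mul_mem hd he, by simpa [mul_assoc] using hex⟩
  intro x
  rw [mem_closure_iff_nhds]
  intro W hW
  have hW' : (fun z : L => x * z⁻¹) ⁻¹' W ∈ 𝓝 (1 : L) :=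
    (by fun_prop : Continuous fun z : L => x * z⁻¹).continuousAt.preimage_mem_nhds
      (by simpa using hW)
  obtain ⟨n, hn⟩ := h.exists_subset _ hW'
  obtain ⟨d, hd, hdx⟩ := hDn n x
  exact ⟨d, by simpa using hn hdx, hd⟩

theorem isUniform_of_zero_eq_top (h : IsOpenPowerFiltration p K) (hp : p.Prime) [T2Space L]
    (h0 : K 0 = ⊤) (hs : IsPowSurjective p K) : IsUniform p L := by
  have hK : ∀ j, powSubgroup (⊤ : Subgroup L) (p ^ j) = K j := fun j => by
    rw [← h0]; exact h.powSubgroup_eq hp hs h.exists_subset h.isCompact j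
  have hx0 : ∀ x, x ∈ K 0 := fun x => h0 ▸ Subgroup.mem_top x
  refine ⟨h.isProP hp h0, h.isTopologicallyFG hp h0 hs, ?_, fun i => ?_⟩
  · intro a b
    obtain ⟨x, rfl⟩ := QuotientGroup.mk_surjective a
    obtain ⟨y, rfl⟩ := QuotientGroup.mk_surjective b
    rw [← QuotientGroup.mk_mul, ← QuotientGroup.mk_mul, QuotientGroup.eq, ite_eq_pow_commDepth, hK]
    have := h.commutator_mem 0 _ (hx0 y⁻¹) _ (hx0 x⁻¹)
    simpa [commutatorElement_def, mul_assoc] using this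
  · refine isShiftIso_of_pow ?_ ?_ ?_ ?_ <;> simp only [hK]
    · exact h.pow_mem i
    · exact fun x hx y hy => h.mul_pow_congr hp (h.le_zero _ hx) hy
    · exact fun x hx => ⟨h.mem_of_pow_mem i x hx, h.pow_mem (i + 1) x⟩
    · exact hs i

theorem isUniform (h : IsOpenPowerFiltration p K) (hp : p.Prime) [T2Space L]
    (hs : IsPowSurjective p K) : IsUniform p (K 0) := by
  refine (h.subgroupOf (Subgroup.isClosed_of_isOpen _ (h.isOpen 0))).isUniform_of_zero_eq_top hp
    (Subgroup.subgroupOf_self _) ?_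
  intro i x hx
  obtain ⟨y, hy, hyx⟩ := hs i x hx
  exact ⟨⟨y, h.le_zero _ hy⟩, hy, hyx⟩

theorem isLieFiltration (h : IsOpenPowerFiltration p K) (hp : p.Prime) [T2Space L]
    (hs : IsPowSurjective p K) : IsLieFiltration p K where
  uniform_zero := h.isUniform hp hs
  isOpen := h.isOpen
  antitone := h.antitone
  eq_pow i := (h.powSubgroup_eq hp hs h.exists_subset h.isCompact i).symm

end IsOpenPowerFiltration

/-! ### Elementwise form of the shift isomorphisms -/

namespace IsShiftIso

variable {p i : ℕ} {H : Type*} [Group H]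

theorem mul_pow_mem (h : IsShiftIso p H i) {x y : H}
    (hx : x ∈ powSubgroup (⊤ : Subgroup H) (p ^ i))
    (hy : y ∈ powSubgroup (⊤ : Subgroup H) (p ^ i)) :
    (x ^ p * y ^ p)⁻¹ * (x * y) ^ p ∈ powSubgroup (⊤ : Subgroup H) (p ^ (i + 2)) := by
  obtain ⟨hpow, φ, hφ⟩ := h
  have h1 := map_mul φ (QuotientGroup.mk ⟨x, hx⟩) (QuotientGroup.mk ⟨y, hy⟩)
  rw [← QuotientGroup.mk_mul, hφ, hφ, hφ, ← QuotientGroup.mk_mul, eq_comm, QuotientGroup.eq,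
    Subgroup.mem_subgroupOf] at h1
  exact h1

theorem mem_of_pow_mem (h : IsShiftIso p H i) {x : H}
    (hx : x ∈ powSubgroup (⊤ : Subgroup H) (p ^ i))
    (hxp : x ^ p ∈ powSubgroup (⊤ : Subgroup H) (p ^ (i + 2))) :
    x ∈ powSubgroup (⊤ : Subgroup H) (p ^ (i + 1)) := by
  obtain ⟨hpow, φ, hφ⟩ := h
  have h1 : φ (QuotientGroup.mk ⟨x, hx⟩) = 1 := by
    rw [hφ, QuotientGroup.eq_one_iff, Subgroup.mem_subgroupOf]
    exact hxp
  rw [map_eq_one_iff φ φ.injective, QuotientGroup.eq_one_iff, Subgroup.mem_subgroupOf] at h1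
  exact h1

theorem exists_pow_congr (h : IsShiftIso p H i) {x : H}
    (hx : x ∈ powSubgroup (⊤ : Subgroup H) (p ^ (i + 1))) :
    ∃ y ∈ powSubgroup (⊤ : Subgroup H) (p ^ i),
      (y ^ p)⁻¹ * x ∈ powSubgroup (⊤ : Subgroup H) (p ^ (i + 2)) := by
  obtain ⟨hpow, φ, hφ⟩ := h
  obtain ⟨q, hq⟩ := φ.surjective (QuotientGroup.mk ⟨x, hx⟩)
  obtain ⟨y, rfl⟩ := QuotientGroup.mk_surjective q
  rw [hφ, QuotientGroup.eq, Subgroup.mem_subgroupOf] at hq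
  exact ⟨y, y.2, hq⟩

theorem relIndex_eq (h : IsShiftIso p H i) :
    (powSubgroup (⊤ : Subgroup H) (p ^ (i + 1))).relIndex (powSubgroup ⊤ (p ^ i)) =
      (powSubgroup (⊤ : Subgroup H) (p ^ (i + 2))).relIndex (powSubgroup ⊤ (p ^ (i + 1))) := by
  obtain ⟨-, φ, -⟩ := h
  exact Nat.card_congr φ.toEquiv

end IsShiftIso

/-! ### The power filtration of a uniform group -/

theorem powSubgroup_zero (p : ℕ) (H : Type*) [Group H] :
    powSubgroup (⊤ : Subgroup H) (p ^ 0) = ⊤ := by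
  simp [powSubgroup]

theorem antitone_powSubgroup (p : ℕ) {L : Type*} [Group L] (H : Subgroup L) :
    Antitone fun i => powSubgroup H (p ^ i) := by
  refine antitone_nat_of_succ_le fun i => ?_
  unfold powSubgroup
  rw [Subgroup.closure_le]
  rintro _ ⟨y, hy, rfl⟩
  refine Subgroup.subset_closure ⟨y ^ p, pow_mem hy p, ?_⟩
  simp only [← pow_mul, pow_succ']

/-- It suffices to check on generators that commutators with arbitrary elements lie in a normal
subgroup `N`, as this means centrality modulo `N`. -/
theorem commutator_mem_of_closure {L : Type*} [Group L] {N : Subgroup L} [N.Normal] {s : Set L}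
    (hs : ∀ x ∈ s, ∀ y, ⁅x, y⁆ ∈ N) {x : L} (hx : x ∈ Subgroup.closure s) (y : L) :
    ⁅x, y⁆ ∈ N := by
  have key : ∀ z : L, z ∈ (Subgroup.center (L ⧸ N)).comap (QuotientGroup.mk' N) ↔
      ∀ y, ⁅z, y⁆ ∈ N := by
    intro z
    rw [Subgroup.mem_comap, Subgroup.mem_center_iff]
    have h1 : ∀ y, ⁅z, y⁆ ∈ N ↔
        QuotientGroup.mk' N y * QuotientGroup.mk' N z =
          QuotientGroup.mk' N z * QuotientGroup.mk' N y := by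
      intro y
      rw [← QuotientGroup.eq_one_iff, ← QuotientGroup.mk'_apply, map_commutatorElement,
        commutatorElement_eq_one_iff_mul_comm, eq_comm]
    exact ⟨fun h y => (h1 y).2 (h _), fun h q => by
      obtain ⟨y, rfl⟩ := QuotientGroup.mk'_surjective N q
      exact (h1 y).1 (h y)⟩
  have hle : Subgroup.closure s ≤ (Subgroup.center (L ⧸ N)).comap (QuotientGroup.mk' N) := by
    rw [Subgroup.closure_le]
    exact fun x hx => (key x).2 (hs x hx)
  exact (key x).1 (hle hx) y

/-- If `x ↦ x ^ p` is multiplicative modulo `N` on `⁅x, y⁆⁻¹` and `x`, whose product is the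
conjugate `y * x * y⁻¹`, and `⁅x, y⁆ ^ p` vanishes modulo `N`, then `x ^ p` and its conjugate by `y`
agree modulo `N`. -/
theorem commutator_pow_mem {L : Type*} [Group L] {N : Subgroup L} [N.Normal] {p : ℕ} {x y : L}
    (h : (⁅x, y⁆⁻¹ ^ p * x ^ p)⁻¹ * (⁅x, y⁆⁻¹ * x) ^ p ∈ N) (hc : ⁅x, y⁆ ^ p ∈ N) :
    ⁅x ^ p, y⁆ ∈ N := by
  have h1 : ⁅x, y⁆⁻¹ * x = y * x * y⁻¹ := by simp [commutatorElement_def, mul_assoc]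
  have h2 : ⁅x ^ p, y⁆ = x ^ p * ((⁅x, y⁆⁻¹ * x) ^ p)⁻¹ := by
    rw [h1, conj_pow]
    simp [commutatorElement_def, mul_assoc]
  rw [← QuotientGroup.eq_one_iff] at h hc ⊢
  rw [h2]
  simp only [QuotientGroup.mk_mul, QuotientGroup.mk_inv, QuotientGroup.mk_pow] at h hc ⊢
  rw [inv_pow, hc, inv_one, one_mul, inv_mul_eq_one] at h
  rw [← h, mul_inv_cancel]

theorem commutator_sq_mem {L : Type*} [Group L] {N : Subgroup L} [N.Normal] {x y : L}
    (h : ⁅⁅x, y⁆, x⁆ ∈ N) (hc : ⁅x, y⁆ ^ 2 ∈ N) : ⁅x ^ 2, y⁆ ∈ N := by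
  have h2 : ⁅x ^ 2, y⁆ = x * ⁅x, y⁆ * x⁻¹ * ⁅x, y⁆ := by
    simp [commutatorElement_def, mul_assoc, pow_two]
  rw [← QuotientGroup.eq_one_iff] at hc ⊢
  rw [← QuotientGroup.eq_one_iff, ← QuotientGroup.mk'_apply, map_commutatorElement,
        commutatorElement_eq_one_iff_mul_comm] at h
  rw [h2]
  simp only [QuotientGroup.mk'_apply] at h
  simp only [QuotientGroup.mk_mul, QuotientGroup.mk_inv, QuotientGroup.mk_pow] at hc ⊢
  rw [← h, mul_inv_cancel_right, ← pow_two, hc]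

theorem forall_mem_powSubgroup_succ_commutator_mem {p i : ℕ} {H : Type*} [Group H]
    {N : Subgroup H} [N.Normal]
    (h : ∀ x ∈ powSubgroup (⊤ : Subgroup H) (p ^ i), ∀ y, ⁅x ^ p, y⁆ ∈ N) {x : H}
    (hx : x ∈ powSubgroup (⊤ : Subgroup H) (p ^ (i + 1))) (y : H) : ⁅x, y⁆ ∈ N := by
  refine commutator_mem_of_closure ?_ hx y
  rintro _ ⟨z, -, rfl⟩ y
  have := h (z ^ p ^ i) (Subgroup.subset_closure ⟨z, trivial, rfl⟩) y
  rwa [← pow_mul, ← pow_succ] at this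

namespace IsUniform

variable {p : ℕ} {H : Type*} [Group H] [TopologicalSpace H]

theorem commutator_mem_commDepth (h : IsUniform p H) (x y : H) :
    ⁅x, y⁆ ∈ powSubgroup (⊤ : Subgroup H) (p ^ commDepth p) := by
  have := h.abelian (QuotientGroup.mk x) (QuotientGroup.mk y)
  rw [← QuotientGroup.mk_mul, ← QuotientGroup.mk_mul, eq_comm, QuotientGroup.eq,
    ite_eq_pow_commDepth] at this
  have h2 := (powSubgroup_normal (⊤ : Subgroup H) (p ^ commDepth p)).conj_mem _ this (y * x)
  simpa [commutatorElement_def, mul_assoc] using h2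

/-- Induction along the chain: `H ^ (p ^ (i + 1))` is generated by `p`-th powers of elements of
`H ^ (p ^ i)`, and the shift homomorphism kills `⁅x, y⁆`, so that `x ^ p` is central modulo
`H ^ (p ^ (i + 2))`. -/
theorem commutator_mem_succ (h : IsUniform p H) (i : ℕ) {x : H}
    (hx : x ∈ powSubgroup (⊤ : Subgroup H) (p ^ i)) (y : H) :
    ⁅x, y⁆ ∈ powSubgroup (⊤ : Subgroup H) (p ^ (i + 1)) := by
  induction i generalizing x y with
  | zero =>
    exact antitone_powSubgroup p ⊤ (by simpa using one_le_commDepth p)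
      (h.commutator_mem_commDepth x y)
  | succ i ih =>
    refine forall_mem_powSubgroup_succ_commutator_mem (fun x hx y => ?_) hx y
    have hc := ih hx y
    exact commutator_pow_mem ((h.shift i).mul_pow_mem
      (inv_mem (antitone_powSubgroup p ⊤ (Nat.le_succ i) hc)) hx) ((h.shift (i + 1)).1 _ hc)

/-- For `p = 2` the descent of commutators by one step improves to two, through
`⁅x ^ 2, y⁆ = x * ⁅x, y⁆ * x⁻¹ * ⁅x, y⁆`. -/
theorem commutator_mem_add_commDepth (h : IsUniform p H) (i : ℕ) {x : H}
    (hx : x ∈ powSubgroup (⊤ : Subgroup H) (p ^ i)) (y : H) :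
    ⁅x, y⁆ ∈ powSubgroup (⊤ : Subgroup H) (p ^ (i + commDepth p)) := by
  by_cases h2 : p = 2
  · subst h2
    change ⁅x, y⁆ ∈ powSubgroup (⊤ : Subgroup H) (2 ^ (i + 2))
    induction i generalizing x y with
    | zero => exact h.commutator_mem_commDepth x y
    | succ i ih =>
      refine forall_mem_powSubgroup_succ_commutator_mem (fun x hx y => ?_) hx y
      have hc := ih y hx
      rw [Nat.add_right_comm]
      exact commutator_sq_mem (h.commutator_mem_succ (i + 2) hc x) ((h.shift (i + 2)).1 _ hc)
  · rw [commDepth, if_neg h2]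
    exact h.commutator_mem_succ i hx y

theorem isPowerFiltration (h : IsUniform p H) :
    IsPowerFiltration p fun i => powSubgroup (⊤ : Subgroup H) (p ^ i) where
  antitone := antitone_powSubgroup p ⊤
  commutator_mem i _ hx y _ := h.commutator_mem_add_commDepth i hx y
  pow_mem i := (h.shift i).1
  mem_of_pow_mem i _ := (h.shift i).mem_of_pow_mem

theorem isPowSurjective (h : IsUniform p H) :
    IsPowSurjective p fun i => powSubgroup (⊤ : Subgroup H) (p ^ i) :=
  fun i _ => (h.shift i).exists_pow_congr

/-- An open normal subgroup of index `p ^ m` contains all `p ^ m`-th powers. -/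
theorem exists_powSubgroup_subset (h : IsUniform p H) {W : Set H} (hW : W ∈ 𝓝 (1 : H)) :
    ∃ n, (powSubgroup (⊤ : Subgroup H) (p ^ n) : Set H) ⊆ W := by
  have := h.isProP.isTopologicalGroup
  have := h.isProP.compactSpace
  have := h.isProP.totallyDisconnectedSpace
  obtain ⟨W', hW', hW'o, h1⟩ := mem_nhds_iff.mp hW
  obtain ⟨N, hN⟩ := ProfiniteGrp.exist_openNormalSubgroup_sub_open_nhds_of_one hW'o h1
  obtain ⟨m, hm⟩ := h.isProP.index_eq N.toSubgroup inferInstance N.isOpen'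
  refine ⟨m, fun x hx => hW' (hN ?_)⟩
  have hle : powSubgroup (⊤ : Subgroup H) (p ^ m) ≤ N.toSubgroup := by
    unfold powSubgroup
    rw [Subgroup.closure_le]
    rintro _ ⟨y, -, rfl⟩
    simp only [← hm]
    exact N.toSubgroup.pow_index_mem y
  exact hle hx

theorem isCompact_powSubgroup (h : IsUniform p H) (hp : p.Prime) (i : ℕ) :
    IsCompact (powSubgroup (⊤ : Subgroup H) (p ^ i) : Set H) := by
  have := h.isProP.isTopologicalGroup
  have := h.isProP.compactSpace
  have := h.isProP.t2Space
  have h0 : IsCompact (powSubgroup (⊤ : Subgroup H) (p ^ 0) : Set H) := by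
    rw [powSubgroup_zero]; exact isCompact_univ
  rw [h.isPowerFiltration.coe_eq_image_pow hp h.isPowSurjective
    (fun _ => h.exists_powSubgroup_subset) h0 i]
  exact h0.image (continuous_pow _)

end IsUniform

/-- An abelian quotient of finite exponent of a topologically finitely generated group by a closed
normal subgroup is finite: the finite image of a finitely generated dense subgroup is both closed
and dense. -/
theorem IsTopologicallyFG.finite_quotient {L : Type*} [Group L] [TopologicalSpace L]
    [IsTopologicalGroup L] (hfg : IsTopologicallyFG L) {N : Subgroup L} [N.Normal]
    (hN : IsClosed (N : Set L)) {p : ℕ} (hp : 0 < p) (hcomm : ∀ x y : L, ⁅x, y⁆ ∈ N)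
    (hpow : ∀ x : L, x ^ p ∈ N) : Finite (L ⧸ N) := by
  obtain ⟨s, hs, hd⟩ := hfg
  let D : Subgroup (L ⧸ N) := (Subgroup.closure s).map (QuotientGroup.mk' N)
  have hDs : D = Subgroup.closure (QuotientGroup.mk' N '' s) := MonoidHom.map_closure _ _
  have hmul : ∀ a b : L ⧸ N, a * b = b * a := by
    intro a b
    obtain ⟨x, rfl⟩ := QuotientGroup.mk'_surjective N a
    obtain ⟨y, rfl⟩ := QuotientGroup.mk'_surjective N b
    rw [← commutatorElement_eq_one_iff_mul_comm, ← map_commutatorElement, QuotientGroup.mk'_apply,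
      QuotientGroup.eq_one_iff]
    exact hcomm x y
  let _ : CommGroup D := { (inferInstance : Group D) with
    mul_comm := fun a b => Subtype.ext (hmul a b) }
  have hfgD : Group.FG D := by
    rw [Group.fg_iff_subgroup_fg, Subgroup.fg_iff]
    exact ⟨_, hDs.symm, hs.image _⟩
  have htors : IsMulTorsion D := by
    rintro ⟨a, ha⟩
    obtain ⟨x, rfl⟩ := QuotientGroup.mk'_surjective N a
    rw [isOfFinOrder_iff_pow_eq_one]
    refine ⟨p, hp, Subtype.ext ?_⟩
    change (QuotientGroup.mk' N x) ^ p = 1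
    rw [← map_pow, QuotientGroup.mk'_apply, QuotientGroup.eq_one_iff]
    exact hpow x
  have hfin : Finite D := CommGroup.finite_of_fg_isMulTorsion D htors
  have hDcl : IsClosed (D : Set (L ⧸ N)) := by
    have : T1Space (L ⧸ N) := QuotientGroup.instT1Space
    exact Set.Finite.isClosed (Set.toFinite _)
  have hDtop : (D : Set (L ⧸ N)) = Set.univ := by
    rw [← hDcl.closure_eq]
    have hdense : Dense ((QuotientGroup.mk : L → L ⧸ N) '' (Subgroup.closure s : Set L)) :=
      (QuotientGroup.mk_surjective.denseRange).dense_image QuotientGroup.continuous_mk hd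
    exact hdense.closure_eq
  exact Set.finite_univ_iff.mp (hDtop ▸ Set.toFinite (D : Set (L ⧸ N)))

namespace IsUniform

variable {p : ℕ} {H : Type*} [Group H] [TopologicalSpace H]

/-- The subgroups `H ^ (p ^ i)` are closed, and of finite index: `H / H ^ p` is finite and the shift
isomorphisms propagate its order. -/
theorem isOpen_powSubgroup (h : IsUniform p H) (hp : p.Prime) (i : ℕ) :
    IsOpen (powSubgroup (⊤ : Subgroup H) (p ^ i) : Set H) := by
  have := h.isProP.isTopologicalGroup
  have := h.isProP.t2Space
  have hcl : ∀ i, IsClosed (powSubgroup (⊤ : Subgroup H) (p ^ i) : Set H) := fun i =>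
    (h.isCompact_powSubgroup hp i).isClosed
  have h0 : ∀ x, x ∈ powSubgroup (⊤ : Subgroup H) (p ^ 0) := by
    simp only [powSubgroup_zero, Subgroup.mem_top, implies_true]
  have hfin : Finite (H ⧸ powSubgroup (⊤ : Subgroup H) (p ^ 1)) :=
    IsTopologicallyFG.finite_quotient h.finitelyGenerated (hcl 1) hp.pos
      (fun x y => h.commutator_mem_succ 0 (h0 x) y) (fun x => (h.shift 0).1 x (h0 x))
  have hidx : ∀ i, (powSubgroup (⊤ : Subgroup H) (p ^ (i + 1))).relIndex
      (powSubgroup ⊤ (p ^ i)) ≠ 0 := by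
    intro i
    induction i with
    | zero =>
      rw [powSubgroup_zero, Subgroup.relIndex_top_right]
      exact Nat.card_pos.ne'
    | succ i ih => rwa [← (h.shift i).relIndex_eq]
  have hidx' : (powSubgroup (⊤ : Subgroup H) (p ^ i)).index ≠ 0 := by
    induction i with
    | zero => simp only [powSubgroup_zero, Subgroup.index_top, ne_eq, one_ne_zero, not_false_eq_true]
    | succ i ih =>
      rw [← Subgroup.relIndex_mul_index (antitone_powSubgroup p ⊤ (Nat.le_succ i))]
      exact mul_ne_zero (hidx i) ih
  have : (powSubgroup (⊤ : Subgroup H) (p ^ i)).FiniteIndex := ⟨hidx'⟩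
  exact Subgroup.isOpen_of_isClosed_of_finiteIndex _ (hcl i)

theorem isOpenPowerFiltration (h : IsUniform p H) (hp : p.Prime) :
    IsOpenPowerFiltration p fun i => powSubgroup (⊤ : Subgroup H) (p ^ i) where
  toIsPowerFiltration := h.isPowerFiltration
  isOpen := h.isOpen_powSubgroup hp
  isCompact := h.isCompact_powSubgroup hp 0
  exists_subset _ := h.exists_powSubgroup_subset
  exists_relIndex_le := by
    refine ⟨(powSubgroup (⊤ : Subgroup H) (p ^ 1)).relIndex (powSubgroup ⊤ (p ^ 0)), fun i => ?_⟩
    induction i with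
    | zero => exact le_rfl
    | succ i ih => exact (h.shift i).relIndex_eq.symm.trans_le ih

end IsUniform

/-! ### Open uniform subgroups and their closed intersections -/

theorem map_subtype_powSubgroup_top {L : Type*} [Group L] (H : Subgroup L) (n : ℕ) :
    (powSubgroup (⊤ : Subgroup H) n).map H.subtype = powSubgroup H n := by
  unfold powSubgroup
  rw [MonoidHom.map_closure, Set.image_image]
  congr 1
  ext x
  simp

theorem IsOpenPowerFiltration.map_subtype {p : ℕ} {L : Type*} [Group L] [TopologicalSpace L]
    {H : Subgroup L} (hH : IsOpen (H : Set L)) {K : ℕ → Subgroup H}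
    (h : IsOpenPowerFiltration p K) :
    IsOpenPowerFiltration p fun i => (K i).map H.subtype where
  antitone _ _ hij := Subgroup.map_mono (h.antitone hij)
  commutator_mem := by
    rintro i _ ⟨x, hx, rfl⟩ _ ⟨y, hy, rfl⟩
    exact ⟨_, h.commutator_mem i x hx y hy, rfl⟩
  pow_mem := by
    rintro i _ ⟨x, hx, rfl⟩
    exact ⟨_, h.pow_mem i x hx, rfl⟩
  mem_of_pow_mem := by
    rintro i _ ⟨x, hx, rfl⟩ ⟨y, hy, hxy⟩
    refine ⟨x, h.mem_of_pow_mem i x hx ?_, rfl⟩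
    rwa [← H.subtype_injective (hxy.trans (map_pow H.subtype x p).symm)]
  isOpen i := hH.isOpenMap_subtype_val _ (h.isOpen i)
  isCompact := h.isCompact.image continuous_subtype_val
  exists_subset W hW := by
    obtain ⟨n, hn⟩ := h.exists_subset (Subtype.val ⁻¹' W)
      (continuous_subtype_val.continuousAt.preimage_mem_nhds hW)
    refine ⟨n, ?_⟩
    rintro _ ⟨x, hx, rfl⟩
    exact hn hx
  exists_relIndex_le := by
    obtain ⟨B, hB⟩ := h.exists_relIndex_le
    refine ⟨B, fun i => ?_⟩
    rw [Subgroup.relIndex_map_map_of_injective _ _ H.subtype_injective]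
    exact hB i

theorem IsUniform.isOpenPowerFiltration_powSubgroup {p : ℕ} (hp : p.Prime) {L : Type*} [Group L]
    [TopologicalSpace L] {H : Subgroup L} (hH : IsOpen (H : Set L)) (h : IsUniform p H) :
    IsOpenPowerFiltration p fun i => powSubgroup H (p ^ i) := by
  simpa only [map_subtype_powSubgroup_top] using (h.isOpenPowerFiltration hp).map_subtype hH

theorem IsPAdicLieGroup.t2Space {p : ℕ} {G : Type*} [Group G] [TopologicalSpace G]
    (hG : IsPAdicLieGroup p G) : T2Space G := by
  obtain ⟨_, H, hHo, hH⟩ := hG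
  have := hH.isProP.t2Space
  have h1 : IsClosed ({1} : Set G) := by
    have := (Subgroup.isClosed_of_isOpen H hHo).isClosedMap_subtype_val _
      (isClosed_singleton (x := (1 : H)))
    simpa using this
  have : T1Space G := IsTopologicalGroup.t1Space G h1
  infer_instance

end PAdicLie

open PAdicLie in
theorem theorem3 (p : ℕ) (hp : p.Prime) {G : Type*} [Group G] [TopologicalSpace G]
    (hG : PAdicLie.IsPAdicLieGroup p G) (Γ : Subgroup G) (hΓ : IsClosed (Γ : Set G)) :
    PAdicLie.IsPAdicLieGroup p Γ ∧
    ∀ H : Subgroup G, IsOpen (H : Set G) → PAdicLie.IsUniform p H →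
      ∃ k₀ : ℕ, ∀ k ≥ k₀,
        IsOpen ((PAdicLie.powSubgroup H (p ^ k)).subgroupOf Γ : Set Γ) ∧
        PAdicLie.IsUniform p ((PAdicLie.powSubgroup H (p ^ k)).subgroupOf Γ) ∧
        PAdicLie.IsLieFiltration p
          (fun i : ℕ => (PAdicLie.powSubgroup H (p ^ (k + i))).subgroupOf Γ) ∧
        (H.Normal → ∀ i : ℕ, ((PAdicLie.powSubgroup H (p ^ (k + i))).subgroupOf Γ).Normal) := by
  have := hG.1
  have := hG.t2Space
  have main : ∀ H : Subgroup G, IsOpen (H : Set G) → PAdicLie.IsUniform p H →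
      ∃ k₀ : ℕ, ∀ k ≥ k₀,
        IsLieFiltration p (fun i : ℕ => (powSubgroup H (p ^ (k + i))).subgroupOf Γ) := by
    intro H hHo hH
    have h := (hH.isOpenPowerFiltration_powSubgroup hp hHo).subgroupOf hΓ
    obtain ⟨k₀, hk₀⟩ := h.exists_isPowSurjective_shift hp
    exact ⟨k₀, fun k hk => (h.shift k).isLieFiltration hp (hk₀ k hk)⟩
  constructor
  · obtain ⟨H, hHo, hH⟩ := hG.2
    obtain ⟨k₀, hk₀⟩ := main H hHo hH
    exact ⟨inferInstance, _, (hk₀ k₀ le_rfl).isOpen 0, (hk₀ k₀ le_rfl).uniform_zero⟩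
  · intro H hHo hH
    obtain ⟨k₀, hk₀⟩ := main H hHo hH
    refine ⟨k₀, fun k hk => ⟨(hk₀ k hk).isOpen 0, (hk₀ k hk).uniform_zero, hk₀ k hk, fun hN i => ?_⟩⟩
    infer_instance
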